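/- Let $r\in(0,1/2]$. There is a constant $\delta=\delta(r)>0$, depending only on $r$, such that the following holds. Let $A>0$ be real, let $m\ge 1$, and let $c_1,\dots,c_m$ be positive integers with $A\le c_i\le 2A$ for every $i$. Let $X_1,\dots,X_m$ be independent random variables with $\Pr[X_i=c_i]=\Pr[X_i=-c_i]=r$ and $\Pr[X_i=0]=1-2r$, and let $Y_1,\dots,Y_m$ be independent random variables such that $Y_i$ has the same distribution as $X_i$ for every $i$. Put $X=\sum_{i=1}^m X_i$ and $Y=\sum_{i=1}^m Y_i$. Then for every real $d>0$ there is a coupling of $X$ and $Y$ (a joint law whose marginals are the laws of $X$ and of $Y$) such that, if $r<1/2$, \[\Pr[d\le X-Y\le d+2A]\ \ge\ 1-\frac{\delta\,(d+A)}{A\sqrt m},\] and, if $r=1/2$ (the walk that never stands still), the same lower bound holds for $\Pr[d\le X-Y\le d+4A]$. -/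

import Mathlib

open MeasureTheory ProbabilityTheory

/-- The law on `ℤ` of a lazy symmetric step of size `c`: the values `c` and `-c` have
probability `r` each, and the value `0` has the remaining probability `1 - 2 * r`.
It is meant for `0 ≤ r ≤ 1 / 2` and `c ≠ 0`. -/
noncomputable def lazyStepLaw (r : ℝ) (c : ℤ) : Measure ℤ :=
  ENNReal.ofReal r • Measure.dirac c + ENNReal.ofReal r • Measure.dirac (-c)
    + ENNReal.ofReal (1 - 2 * r) • Measure.dirac 0

/-- `γ` is a coupling of the random variables `X` (on the space with law `P`) and `Y` (on the space
with law `Q`): a joint law whose two marginals are the laws of `X` and of `Y`. -/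
def IsCouplingOf {Ω Ω' E F : Type*} [MeasurableSpace Ω] [MeasurableSpace Ω']
    [MeasurableSpace E] [MeasurableSpace F] (γ : Measure (E × F))
    (X : Ω → E) (P : Measure Ω) (Y : Ω' → F) (Q : Measure Ω') : Prop :=
  γ.map Prod.fst = P.map X ∧ γ.map Prod.snd = Q.map Y

/-- For every `d ≥ -a` there is a self-coupling of `ν` whose difference lies in `[d, d + a]`
with a probability `p` satisfying `exp (-θ (d + a)) ≤ p + (1 - p) K`. -/
def HasShiftCouplings (ν : Measure ℤ) (a θ K : ℝ) : Prop :=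
  ∀ d : ℝ, -a ≤ d → ∃ γ : Measure (ℤ × ℤ), IsProbabilityMeasure γ ∧
    γ.map Prod.fst = ν ∧ γ.map Prod.snd = ν ∧
    Real.exp (-(θ * (d + a))) ≤
      γ.real {p : ℤ × ℤ | d ≤ (p.1 : ℝ) - (p.2 : ℝ) ∧ (p.1 : ℝ) - (p.2 : ℝ) ≤ d + a}
        + (1 - γ.real {p : ℤ × ℤ | d ≤ (p.1 : ℝ) - (p.2 : ℝ) ∧
            (p.1 : ℝ) - (p.2 : ℝ) ≤ d + a}) * K

theorem exists_diagonal_coupling (ν : Measure ℤ) [IsProbabilityMeasure ν] {a θ K d : ℝ}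
    (hθ : 0 ≤ θ) (hd : -a ≤ d) (hd0 : d ≤ 0) :
    ∃ γ : Measure (ℤ × ℤ), IsProbabilityMeasure γ ∧
    γ.map Prod.fst = ν ∧ γ.map Prod.snd = ν ∧
    Real.exp (-(θ * (d + a))) ≤
      γ.real {p : ℤ × ℤ | d ≤ (p.1 : ℝ) - (p.2 : ℝ) ∧ (p.1 : ℝ) - (p.2 : ℝ) ≤ d + a}
        + (1 - γ.real {p : ℤ × ℤ | d ≤ (p.1 : ℝ) - (p.2 : ℝ) ∧
            (p.1 : ℝ) - (p.2 : ℝ) ≤ d + a}) * K := by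
  have hm : Measurable (fun x : ℤ => (x, x)) := measurable_of_countable _
  refine ⟨ν.map (fun x => (x, x)), Measure.isProbabilityMeasure_map hm.aemeasurable, ?_, ?_, ?_⟩
  · rw [Measure.map_map measurable_fst hm]
    exact Measure.map_id
  · rw [Measure.map_map measurable_snd hm]
    exact Measure.map_id
  · have h1 : (ν.map (fun x : ℤ => (x, x))).real {p : ℤ × ℤ | d ≤ (p.1 : ℝ) - (p.2 : ℝ) ∧
        (p.1 : ℝ) - (p.2 : ℝ) ≤ d + a} = 1 := by
      rw [map_measureReal_apply hm (Set.to_countable _).measurableSet]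
      have : (fun x : ℤ => (x, x)) ⁻¹' {p : ℤ × ℤ | d ≤ (p.1 : ℝ) - (p.2 : ℝ) ∧
        (p.1 : ℝ) - (p.2 : ℝ) ≤ d + a} = Set.univ := by
        ext x
        simp only [Set.mem_preimage, Set.mem_ofPred_eq, sub_self, Set.mem_univ, iff_true]
        constructor <;> linarith
      rw [this, probReal_univ]
    rw [h1, sub_self, zero_mul, add_zero, Real.exp_le_one_iff]
    have : 0 ≤ θ * (d + a) := mul_nonneg hθ (by linarith)
    linarith

theorem hasShiftCouplings_dirac_zero {a θ : ℝ} (hθ : 0 ≤ θ) :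
    HasShiftCouplings (Measure.dirac 0) a θ 1 := by
  intro d hd
  refine ⟨Measure.dirac 0, inferInstance, ?_, ?_, ?_⟩
  · rw [Measure.map_dirac' measurable_fst]; rfl
  · rw [Measure.map_dirac' measurable_snd]; rfl
  · rw [mul_one, add_sub_cancel, Real.exp_le_one_iff]
    have : 0 ≤ θ * (d + a) := mul_nonneg hθ (by linarith)
    linarith

theorem finset_sum_smul_dirac_conv {κ : Type*} (s : Finset κ) (w : κ → ℝ) (u : κ → ℤ)
    (ν : Measure ℤ) [IsProbabilityMeasure ν] :
    (∑ k ∈ s, ENNReal.ofReal (w k) • Measure.dirac (u k)) ∗ ν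
      = ∑ k ∈ s, ENNReal.ofReal (w k) • ν.map (fun x => u k + x) := by
  classical
  have hfin : ∀ t : Finset κ,
      IsFiniteMeasure (∑ k ∈ t, ENNReal.ofReal (w k) • Measure.dirac (u k)) := by
    intro t
    refine ⟨?_⟩
    rw [Measure.finsetSum_apply]
    refine ENNReal.sum_lt_top.2 fun k _ => ?_
    simp
  induction s using Finset.induction_on with
  | empty => simp
  | insert k t hk ih =>
    have := hfin t
    have : IsFiniteMeasure (ENNReal.ofReal (w k) • Measure.dirac (u k)) := by
      simpa using hfin {k}
    rw [Finset.sum_insert hk, Finset.sum_insert hk, Measure.add_conv, ih,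
      Measure.conv_smul_left, Measure.dirac_conv]

/-- Prefixing a step whose two coordinates are coupled through finitely many joint values
`(u k, v k)` with weights `w k`. -/
theorem HasShiftCouplings.conv {κ : Type*} [Fintype κ] {w : κ → ℝ} {u v : κ → ℤ}
    {μ ν : Measure ℤ} [IsProbabilityMeasure μ] [IsProbabilityMeasure ν] {a θ K M : ℝ}
    (h : HasShiftCouplings ν a θ K)
    (hw : ∀ k, 0 ≤ w k) (hw1 : ∑ k, w k = 1)
    (hu : μ = ∑ k, ENNReal.ofReal (w k) • Measure.dirac (u k))
    (hv : μ = ∑ k, ENNReal.ofReal (w k) • Measure.dirac (v k))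
    (ha : ∀ k, (u k : ℝ) - v k ≤ a) (hθ : 0 ≤ θ) (hM1 : 1 ≤ M)
    (hM : M ≤ ∑ k, w k * Real.exp (θ * ((u k : ℝ) - v k))) :
    HasShiftCouplings (μ ∗ ν) a θ (K / M) := by
  intro d hd
  rcases le_or_gt d 0 with hd0 | hd0
  · exact exists_diagonal_coupling _ hθ hd hd0
  choose g hgP hg1 hg2 hg using fun k => h (d - ((u k : ℝ) - v k)) (by linarith [ha k])
  have hT : ∀ k, Measurable (fun p : ℤ × ℤ => (u k + p.1, v k + p.2)) :=
    fun k => measurable_of_countable _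
  have hS : MeasurableSet {p : ℤ × ℤ | d ≤ (p.1 : ℝ) - (p.2 : ℝ) ∧
      (p.1 : ℝ) - (p.2 : ℝ) ≤ d + a} := (Set.to_countable _).measurableSet
  have hgm : ∀ k, IsProbabilityMeasure ((g k).map (fun p : ℤ × ℤ => (u k + p.1, v k + p.2))) :=
    fun k => Measure.isProbabilityMeasure_map (hT k).aemeasurable
  refine ⟨∑ k, ENNReal.ofReal (w k) • (g k).map (fun p : ℤ × ℤ => (u k + p.1, v k + p.2)),
    ?_, ?_, ?_, ?_⟩
  · refine ⟨?_⟩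
    rw [Measure.finsetSum_apply]
    simp only [Measure.smul_apply, measure_univ, smul_eq_mul, mul_one]
    rw [← ENNReal.ofReal_sum_of_nonneg fun k _ => hw k, hw1, ENNReal.ofReal_one]
  · rw [hu, finset_sum_smul_dirac_conv, Measure.map_finset_sum' measurable_fst.aemeasurable]
    refine Finset.sum_congr rfl fun k _ => ?_
    rw [Measure.map_smul, Measure.map_map measurable_fst (hT k), ← hg1 k,
      Measure.map_map (measurable_of_countable _) measurable_fst]
    rfl
  · rw [hv, finset_sum_smul_dirac_conv, Measure.map_finset_sum' measurable_snd.aemeasurable]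
    refine Finset.sum_congr rfl fun k _ => ?_
    rw [Measure.map_smul, Measure.map_map measurable_snd (hT k), ← hg2 k,
      Measure.map_map (measurable_of_countable _) measurable_snd]
    rfl
  · set p : κ → ℝ := fun k => (g k).real {p : ℤ × ℤ | d - ((u k : ℝ) - v k) ≤
      (p.1 : ℝ) - (p.2 : ℝ) ∧ (p.1 : ℝ) - (p.2 : ℝ) ≤ d - ((u k : ℝ) - v k) + a} with hp
    have hreal : (∑ k, ENNReal.ofReal (w k) •
        (g k).map (fun p : ℤ × ℤ => (u k + p.1, v k + p.2))).real
          {p : ℤ × ℤ | d ≤ (p.1 : ℝ) - (p.2 : ℝ) ∧ (p.1 : ℝ) - (p.2 : ℝ) ≤ d + a}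
        = ∑ k, w k * p k := by
      rw [Measure.real, Measure.finsetSum_apply, ENNReal.toReal_sum]
      · refine Finset.sum_congr rfl fun k _ => ?_
        rw [Measure.smul_apply, smul_eq_mul, ENNReal.toReal_mul, ENNReal.toReal_ofReal (hw k),
          Measure.map_apply (hT k) hS]
        congr 3
        ext q
        simp only [Set.mem_preimage, Set.mem_ofPred_eq]
        push_cast
        constructor <;> rintro ⟨h1, h2⟩ <;> constructor <;> linarith
      · intro k _
        rw [Measure.smul_apply, smul_eq_mul]
        exact ENNReal.mul_ne_top ENNReal.ofReal_ne_top (measure_ne_top _ _)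
    rw [hreal]
    have hM0 : 0 < M := by linarith
    have hsum : ∑ k, w k * Real.exp (-(θ * (d - ((u k : ℝ) - v k) + a)))
        ≤ ∑ k, w k * (p k + (1 - p k) * K) :=
      Finset.sum_le_sum fun k _ => mul_le_mul_of_nonneg_left (hg k) (hw k)
    have hL : ∑ k, w k * Real.exp (-(θ * (d - ((u k : ℝ) - v k) + a)))
        = Real.exp (-(θ * (d + a))) * ∑ k, w k * Real.exp (θ * ((u k : ℝ) - v k)) := by
      rw [Finset.mul_sum]
      refine Finset.sum_congr rfl fun k _ => ?_
      rw [mul_left_comm, ← Real.exp_add]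
      ring_nf
    have hR : ∑ k, w k * (p k + (1 - p k) * K)
        = ∑ k, w k * p k + (1 - ∑ k, w k * p k) * K := by
      conv_rhs => rw [← hw1, ← Finset.sum_sub_distrib, Finset.sum_mul, ← Finset.sum_add_distrib]
      refine Finset.sum_congr rfl fun k _ => ?_
      ring
    rw [hL, hR] at hsum
    have hp0 : 0 ≤ ∑ k, w k * p k :=
      Finset.sum_nonneg fun k _ => mul_nonneg (hw k) measureReal_nonneg
    have key : Real.exp (-(θ * (d + a))) * M
        ≤ ∑ k, w k * p k + (1 - ∑ k, w k * p k) * K :=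
      (mul_le_mul_of_nonneg_left hM (Real.exp_pos _).le).trans hsum
    have hpM : ∑ k, w k * p k ≤ (∑ k, w k * p k) * M := le_mul_of_one_le_right hp0 hM1
    rw [← mul_le_mul_iff_left₀ hM0]
    calc _ ≤ (∑ k, w k * p k) * M + (1 - ∑ k, w k * p k) * K := by linarith
      _ = _ := by field_simp

theorem isProbabilityMeasure_lazyStepLaw {r : ℝ} (hr0 : 0 ≤ r) (hr : r ≤ 1 / 2) (c : ℤ) :
    IsProbabilityMeasure (lazyStepLaw r c) := by
  refine ⟨?_⟩
  simp only [lazyStepLaw, Measure.add_apply, Measure.smul_apply, measure_univ, smul_eq_mul,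
    mul_one]
  rw [← ENNReal.ofReal_add hr0 hr0, ← ENNReal.ofReal_add (by linarith) (by linarith),
    ← ENNReal.ofReal_one]
  congr 1
  ring

theorem two_add_sq_le_exp_add_exp_neg (x : ℝ) : 2 + x ^ 2 ≤ Real.exp x + Real.exp (-x) := by
  have key : ∀ y : ℝ, 0 ≤ y → 2 + y ^ 2 ≤ Real.exp y + Real.exp (-y) := by
    intro y hy
    have h := Real.cosh_sq (y / 2)
    have h2 := Real.cosh_two_mul (y / 2)
    have h3 : y / 2 ≤ Real.sinh (y / 2) := Real.self_le_sinh_iff.2 (by linarith)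
    have h4 : Real.cosh y = 1 + 2 * Real.sinh (y / 2) ^ 2 := by
      rw [show 2 * (y / 2) = y by ring] at h2
      linarith
    rw [Real.cosh_eq] at h4
    nlinarith
  rcases le_total 0 x with h | h
  · exact key x h
  · have := key (-x) (by linarith)
    rw [neg_neg] at this
    nlinarith

/-- The mirror coupling `(c, -c)`, `(-c, c)`, `(0, 0)`. -/
theorem HasShiftCouplings.lazyStepLaw_conv_mirror {r : ℝ} (hr0 : 0 ≤ r) (hr : r ≤ 1 / 2) {c : ℤ}
    {ν : Measure ℤ} [IsProbabilityMeasure ν] {a θ K : ℝ} (h : HasShiftCouplings ν a θ K)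
    (hθ : 0 ≤ θ) (hc0 : 0 ≤ c) (hca : 2 * (c : ℝ) ≤ a) {M : ℝ} (hM1 : 1 ≤ M)
    (hM : M ≤ 1 + 4 * r * (θ * c) ^ 2) :
    HasShiftCouplings (lazyStepLaw r c ∗ ν) a θ (K / M) := by
  have := isProbabilityMeasure_lazyStepLaw hr0 hr c
  have hc0' : (0 : ℝ) ≤ c := by exact_mod_cast hc0
  refine h.conv (w := ![r, r, 1 - 2 * r]) (u := ![c, -c, 0]) (v := ![-c, c, 0]) ?_ ?_ ?_ ?_ ?_
    hθ hM1 (hM.trans ?_)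
  · intro k
    fin_cases k <;> simp <;> linarith
  · simp [Fin.sum_univ_succ]
    ring
  · simp [lazyStepLaw, Fin.sum_univ_succ, add_assoc]
  · simp [lazyStepLaw, Fin.sum_univ_succ]
    abel
  · intro k
    fin_cases k <;> simp <;> linarith
  · simp only [Fin.sum_univ_three, Matrix.cons_val]
    push_cast
    have h1 := two_add_sq_le_exp_add_exp_neg (θ * (2 * c))
    rw [show θ * ((c : ℝ) - -c) = θ * (2 * c) by ring,
      show θ * (-(c : ℝ) - c) = -(θ * (2 * c)) by ring, sub_zero, mul_zero, Real.exp_zero]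
    nlinarith [mul_le_mul_of_nonneg_left h1 hr0]

/-- The coupling in which one of the two walks stands still whenever their difference changes. -/
theorem HasShiftCouplings.lazyStepLaw_conv_alternate {r s : ℝ} (hs0 : 0 ≤ s) (hsr : s ≤ r)
    (hs : 2 * s ≤ 1 - 2 * r) {c : ℤ}
    {ν : Measure ℤ} [IsProbabilityMeasure ν] {a θ K : ℝ} (h : HasShiftCouplings ν a θ K)
    (hθ : 0 ≤ θ) (hc0 : 0 ≤ c) (hca : (c : ℝ) ≤ a) {M : ℝ} (hM1 : 1 ≤ M)
    (hM : M ≤ 1 + 2 * s * (θ * c) ^ 2) :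
    HasShiftCouplings (lazyStepLaw r c ∗ ν) a θ (K / M) := by
  have := isProbabilityMeasure_lazyStepLaw (r := r) (by linarith) (by linarith) c
  have hc0' : (0 : ℝ) ≤ c := by exact_mod_cast hc0
  have e1 : ENNReal.ofReal r = ENNReal.ofReal s + ENNReal.ofReal (r - s) := by
    rw [← ENNReal.ofReal_add hs0 (by linarith)]
    congr 1
    ring
  have e2 : ENNReal.ofReal (1 - 2 * r)
      = ENNReal.ofReal s + ENNReal.ofReal s + ENNReal.ofReal (1 - 2 * r - 2 * s) := by
    rw [← ENNReal.ofReal_add hs0 hs0, ← ENNReal.ofReal_add (by linarith) (by linarith)]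
    congr 1
    ring
  refine h.conv (w := ![s, s, s, s, r - s, r - s, 1 - 2 * r - 2 * s])
    (u := ![c, 0, 0, -c, c, -c, 0]) (v := ![0, -c, c, 0, c, -c, 0]) ?_ ?_ ?_ ?_ ?_
    hθ hM1 (hM.trans ?_)
  · intro k
    fin_cases k <;> simp <;> linarith
  · simp [Fin.sum_univ_succ]
    ring
  · simp only [lazyStepLaw, Fin.sum_univ_seven, Matrix.cons_val, e1, e2, add_smul]
    abel
  · simp only [lazyStepLaw, Fin.sum_univ_seven, Matrix.cons_val, e1, e2, add_smul]
    abel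
  · intro k
    fin_cases k <;> simp <;> linarith
  · simp only [Fin.sum_univ_seven, Matrix.cons_val]
    push_cast
    have h1 := two_add_sq_le_exp_add_exp_neg (θ * c)
    simp only [sub_self, sub_zero, zero_sub, neg_neg, mul_zero, Real.exp_zero, mul_neg]
    nlinarith [mul_le_mul_of_nonneg_left h1 hs0]

theorem map_sum_eq_of_map_eq {ι Ω Ω' : Type*} [Fintype ι] [MeasurableSpace Ω] [MeasurableSpace Ω']
    {P : Measure Ω} [IsProbabilityMeasure P] {Q : Measure Ω'} [IsProbabilityMeasure Q]
    {X : ι → Ω → ℤ} {Y : ι → Ω' → ℤ} {μ : ι → Measure ℤ}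
    (hX : iIndepFun X P) (hXL : ∀ i, HasLaw (X i) (μ i) P)
    (hY : iIndepFun Y Q) (hYL : ∀ i, HasLaw (Y i) (μ i) Q) :
    P.map (fun ω => ∑ i, X i ω) = Q.map (fun ω => ∑ i, Y i ω) := by
  have hX' := (iIndepFun_iff_map_fun_eq_pi_map fun i => (hXL i).aemeasurable).1 hX
  have hY' := (iIndepFun_iff_map_fun_eq_pi_map fun i => (hYL i).aemeasurable).1 hY
  simp only [(hXL _).map_eq] at hX'
  simp only [(hYL _).map_eq] at hY'
  have hm : Measurable (fun x : ι → ℤ => ∑ i, x i) := by fun_prop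
  have h1 := AEMeasurable.map_map_of_aemeasurable (μ := P) hm.aemeasurable
    (aemeasurable_pi_lambda (fun ω i => X i ω) fun i => (hXL i).aemeasurable)
  have h2 := AEMeasurable.map_map_of_aemeasurable (μ := Q) hm.aemeasurable
    (aemeasurable_pi_lambda (fun ω i => Y i ω) fun i => (hYL i).aemeasurable)
  rw [hX'] at h1
  rw [hY'] at h2
  exact h1.symm.trans h2

theorem hasShiftCouplings_map_sum {ι Ω : Type*} [MeasurableSpace Ω]
    {P : Measure Ω} [IsProbabilityMeasure P] {X : ι → Ω → ℤ} {μ : ι → Measure ℤ}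
    (hX : iIndepFun X P) (hXL : ∀ i, HasLaw (X i) (μ i) P) {a θ M : ℝ} (hθ : 0 ≤ θ)
    (hstep : ∀ i, ∀ (ν : Measure ℤ) [IsProbabilityMeasure ν], ∀ K : ℝ,
      HasShiftCouplings ν a θ K → HasShiftCouplings (μ i ∗ ν) a θ (K / M)) (s : Finset ι) :
    HasShiftCouplings (P.map (∑ i ∈ s, X i)) a θ ((M ^ s.card)⁻¹) := by
  classical
  induction s using Finset.induction_on with
  | empty =>
    have : P.map (0 : Ω → ℤ) = Measure.dirac 0 := by
      change P.map (fun _ => (0 : ℤ)) = _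
      simp [Measure.map_const]
    simpa [this] using hasShiftCouplings_dirac_zero hθ
  | insert i s hi ih =>
    have hm : AEMeasurable (∑ j ∈ s, X j) P :=
      Finset.aemeasurable_sum s fun j _ => (hXL j).aemeasurable
    have hind := (hX.indepFun_finsetSum_of_notMem₀ (fun j => (hXL j).aemeasurable) hi).symm
    rw [Finset.sum_insert hi, hind.map_add_eq_map_conv_map₀ (hXL i).aemeasurable hm,
      (hXL i).map_eq, Finset.card_insert_of_notMem hi]
    have : IsProbabilityMeasure (P.map (∑ j ∈ s, X j)) := Measure.isProbabilityMeasure_map hm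
    convert hstep i _ _ ih using 1
    rw [pow_succ, mul_inv, div_eq_mul_inv]

theorem one_sub_le_of_exp_neg_le {p x q K : ℝ} (hq : 0 < q) (hp : p ≤ 1) (hK : K ≤ (1 + q)⁻¹)
    (h : Real.exp (-x) ≤ p + (1 - p) * K) : 1 - (1 + q) / q * x ≤ p := by
  have h1 := Real.add_one_le_exp (-x)
  have h2 : (1 - p) * K ≤ (1 - p) * (1 + q)⁻¹ := mul_le_mul_of_nonneg_left hK (by linarith)
  have h3 : (1 - p) * (1 - (1 + q)⁻¹) ≤ x := by linarith
  have h4 : 1 - (1 + q)⁻¹ = q / (1 + q) := by field_simp; ring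
  rw [h4, mul_div_assoc', div_le_iff₀ (by linarith)] at h3
  have h5 : 1 - p ≤ (1 + q) / q * x := by
    rw [div_mul_eq_mul_div, le_div_iff₀ hq]
    linarith
  linarith

/-- If every step of a walk can be coupled with exponential gain `1 + q / m` at the scale
`θ = 1 / (A √m)`, then the two copies of the walk can be shifted by about `d`. -/
theorem exists_coupling_of_step {m : ℕ} (hm : 1 ≤ m) {A : ℝ} (hA : 0 < A)
    {Ω Ω' : Type*} [MeasurableSpace Ω] [MeasurableSpace Ω']
    {P : Measure Ω} [IsProbabilityMeasure P] {Q : Measure Ω'} [IsProbabilityMeasure Q]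
    {X : Fin m → Ω → ℤ} {Y : Fin m → Ω' → ℤ} {μ : Fin m → Measure ℤ}
    (hX : iIndepFun X P) (hXL : ∀ i, HasLaw (X i) (μ i) P)
    (hY : iIndepFun Y Q) (hYL : ∀ i, HasLaw (Y i) (μ i) Q)
    {q a : ℝ} (hq : 0 < q) (ha0 : 0 ≤ a) (ha : a ≤ 4 * A)
    (hstep : ∀ i, ∀ (ν : Measure ℤ) [IsProbabilityMeasure ν], ∀ K : ℝ,
      HasShiftCouplings ν a (1 / (A * √(m : ℝ))) K →
        HasShiftCouplings (μ i ∗ ν) a (1 / (A * √(m : ℝ))) (K / (1 + q / m)))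
    {d : ℝ} (hd : 0 < d) :
    ∃ γ : Measure (ℤ × ℤ), IsCouplingOf γ (fun ω => ∑ i, X i ω) P (fun ω => ∑ i, Y i ω) Q ∧
      1 - 4 * ((1 + q) / q) * (d + A) / (A * √(m : ℝ)) ≤
        γ.real {p : ℤ × ℤ | d ≤ (p.1 : ℝ) - (p.2 : ℝ) ∧ (p.1 : ℝ) - (p.2 : ℝ) ≤ d + a} := by
  have hm0 : (0 : ℝ) < m := by exact_mod_cast hm
  have hAm : 0 < A * √(m : ℝ) := mul_pos hA (Real.sqrt_pos.2 hm0)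
  obtain ⟨γ, hγ, h1, h2, h3⟩ := hasShiftCouplings_map_sum hX hXL (one_div_nonneg.2 hAm.le) hstep
    Finset.univ d (by linarith)
  have hsum : (∑ i, X i) = fun ω => ∑ i, X i ω := by
    ext ω
    simp
  rw [hsum] at h1 h2
  refine ⟨γ, ⟨h1, h2.trans (map_sum_eq_of_map_eq hX hXL hY hYL)⟩, ?_⟩
  have hb := one_add_mul_le_pow (a := q / m) (by have := div_pos hq hm0; linarith) m
  rw [mul_div_cancel₀ _ hm0.ne'] at hb
  have hfin := one_sub_le_of_exp_neg_le hq measureReal_le_one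
    (inv_anti₀ (by linarith) (by simpa using hb)) h3
  refine le_trans ?_ hfin
  have : 4 * ((1 + q) / q) * (d + A) / (A * √(m : ℝ))
      = (1 + q) / q * (1 / (A * √(m : ℝ)) * (4 * (d + A))) := by ring
  rw [this]
  gcongr
  linarith

theorem div_le_mul_sq_of_le {A c q : ℝ} (hA : 0 < A) (hc : A ≤ c) (hq : 0 ≤ q) {m : ℕ}
    (hm : 1 ≤ m) : q / m ≤ q * (1 / (A * √(m : ℝ)) * c) ^ 2 := by
  have hm0 : (0 : ℝ) < m := by exact_mod_cast hm
  have h : (1 / (A * √(m : ℝ)) * c) ^ 2 = (c / A) ^ 2 * (1 / m) := by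
    rw [mul_pow, div_pow, mul_pow, Real.sq_sqrt hm0.le]
    field_simp
  rw [h, div_eq_mul_one_div q]
  refine mul_le_mul_of_nonneg_left ?_ hq
  have : 1 ≤ (c / A) ^ 2 := one_le_pow₀ ((one_le_div hA).2 hc)
  exact le_mul_of_one_le_left (by positivity) this

theorem mainTheorem7 (r : ℝ) (hr0 : 0 < r) (hr : r ≤ 1 / 2) :
    ∃ δ : ℝ, 0 < δ ∧
      ∀ (A : ℝ), 0 < A →
      ∀ (m : ℕ), 1 ≤ m →
      ∀ (c : Fin m → ℕ), (∀ i, A ≤ (c i : ℝ) ∧ (c i : ℝ) ≤ 2 * A) →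
      ∀ {Ω Ω' : Type*} [MeasurableSpace Ω] [MeasurableSpace Ω']
        (P : Measure Ω) [IsProbabilityMeasure P] (Q : Measure Ω') [IsProbabilityMeasure Q]
        (X : Fin m → Ω → ℤ) (Y : Fin m → Ω' → ℤ),
        iIndepFun X P → (∀ i, HasLaw (X i) (lazyStepLaw r (c i)) P) →
        iIndepFun Y Q → (∀ i, HasLaw (Y i) (lazyStepLaw r (c i)) Q) →
      ∀ (d : ℝ), 0 < d →
        ∃ γ : Measure (ℤ × ℤ),
          IsCouplingOf γ (fun ω => ∑ i, X i ω) P (fun ω => ∑ i, Y i ω) Q ∧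
          (r < 1 / 2 →
            1 - δ * (d + A) / (A * √(m : ℝ)) ≤
              γ.real {p : ℤ × ℤ | d ≤ (p.1 : ℝ) - (p.2 : ℝ) ∧
                (p.1 : ℝ) - (p.2 : ℝ) ≤ d + 2 * A}) ∧
          (r = 1 / 2 →
            1 - δ * (d + A) / (A * √(m : ℝ)) ≤
              γ.real {p : ℤ × ℤ | d ≤ (p.1 : ℝ) - (p.2 : ℝ) ∧
                (p.1 : ℝ) - (p.2 : ℝ) ≤ d + 4 * A}) := by
  rcases lt_or_ge r (1 / 2) with hlt | hge
  · set s : ℝ := min r ((1 - 2 * r) / 2) with hs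
    have hs0 : 0 < s := lt_min hr0 (by linarith)
    have hs2 : 2 * s ≤ 1 - 2 * r := by linarith [min_le_right r ((1 - 2 * r) / 2)]
    refine ⟨4 * ((1 + 2 * s) / (2 * s)), by positivity, ?_⟩
    intro A hA m hm c hc Ω Ω' _ _ P _ Q _ X Y hX hXL hY hYL d hd
    obtain ⟨γ, hγ, hp⟩ := exists_coupling_of_step hm hA hX hXL hY hYL (q := 2 * s) (a := 2 * A)
      (by positivity) (by positivity) (by linarith)
      (fun i ν _ K h => h.lazyStepLaw_conv_alternate hs0.le (min_le_left _ _) hs2 (by positivity)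
        (by positivity) (by exact_mod_cast (hc i).2) (by simp; positivity)
        (by
          have := div_le_mul_sq_of_le hA (hc i).1 (mul_nonneg zero_le_two hs0.le) hm
          push_cast
          linarith)) hd
    exact ⟨γ, hγ, fun _ => hp, fun h => absurd h hlt.ne⟩
  · refine ⟨4 * ((1 + 4 * r) / (4 * r)), by positivity, ?_⟩
    intro A hA m hm c hc Ω Ω' _ _ P _ Q _ X Y hX hXL hY hYL d hd
    obtain ⟨γ, hγ, hp⟩ := exists_coupling_of_step hm hA hX hXL hY hYL (q := 4 * r) (a := 4 * A)
      (by positivity) (by positivity) le_rfl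
      (fun i ν _ K h => h.lazyStepLaw_conv_mirror hr0.le hr (by positivity)
        (by positivity) (by have := (hc i).2; push_cast; linarith) (by simp; positivity)
        (by
          have := div_le_mul_sq_of_le hA (hc i).1 (mul_nonneg zero_le_four hr0.le) hm
          push_cast
          linarith)) hd
    exact ⟨γ, hγ, fun h => absurd h hge.not_gt, fun _ => hp⟩
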